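/- Let $n,t\ge 0$ be integers and let $C_X,C_Z\subseteq\{0,1\}^n$ be binary linear codes of dimensions $k_x,k_z$ with $C_Z^\perp\subseteq C_X$, defining a CSS code with $k=k_x+k_z-n$ logical qubits; suppose that $C_X$ corrects $t$ errors, i.e. some decoder recovers every codeword of $C_X$ after any corruption of at most $t$ bits. Let $|\overline{+}\rangle=|C_Z|^{-1/2}\sum_{w\in C_Z}|w\rangle$ be the encoded state $|+\rangle^{\otimes k}$, let $U(\theta)=(e^{i\theta Z})^{\otimes n}$ with $\theta\in\mathbb R$, and let $p(x)=|\langle x|H^{\otimes n}U(\theta)|\overline{+}\rangle|^2$ for $x\in\{0,1\}^n$. Let $T\in\mathrm{GL}(n,\mathbb F_2)$ be an unencoding map for the $X$-part of the code: its first $k$ rows lie in $C_Z$ and its next $n-k_x$ rows lie in $C_X^\perp$ (so that the latter form a basis of $C_X^\perp$ and the former a basis of $C_Z$ modulo $C_X^\perp$). Let $q(y)=p(T^{-1}y)$ be the distribution of $y=Tx$ for $x\sim p$; the first $k$ bits of $y$ are the logical bits and the next $n-k_x$ bits are the syndrome. Assume $$|\theta|\le\arcsin\left(\frac{t/n}{2e(4e+2)}\right)$$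 (where $t/n$ is read as $0$ if $n=0$). Then, with probability $1-\mathsf{negl}(t)$ over a syndrome $s\in\{0,1\}^{n-k_x}$ drawn from the syndrome marginal of $q$, there is a logical string $l_s\in\{0,1\}^k$ with $$\Pr_{y\sim q}\left[\,y_{[1,k]}=l_s\;\middle|\;y_{[k+1,k+(n-k_x)]}=s\,\right]\ge 1-\mathsf{negl}(t).$$ Here $\mathsf{negl}:\mathbb N\to\mathbb R$ is one negligible function (decaying faster than every inverse polynomial), the same for all $n$, $t$, codes, $T$ and $\theta$. -/

import Mathlib

open scoped Matrix

/-- Bit strings of length `n`, that is, the space `{0,1}^n` over the two-element field. -/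
abbrev Bits (n : ℕ) : Type := Fin n → ZMod 2

noncomputable section

/-! ### Binary linear codes and CSS codes -/

/-- The dual code `C^⊥` of a binary linear code. -/
def dualCode {n : ℕ} (C : Submodule (ZMod 2) (Bits n)) : Submodule (ZMod 2) (Bits n) where
  carrier := {v | ∀ c ∈ C, v ⬝ᵥ c = 0}
  add_mem' := by
    intro a b ha hb c hc
    rw [add_dotProduct, ha c hc, hb c hc, add_zero]
  zero_mem' := by
    intro c _
    exact zero_dotProduct c
  smul_mem' := by
    intro r a ha c hc
    rw [smul_dotProduct, ha c hc, smul_zero]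

/-- The code `C` corrects `t` errors: some decoder recovers every codeword from every corruption
of it in at most `t` positions. -/
def CorrectsErrors {n : ℕ} (C : Submodule (ZMod 2) (Bits n)) (t : ℕ) : Prop :=
  ∃ D : Bits n → Bits n, ∀ c ∈ C, ∀ e : Bits n, hammingNorm e ≤ t → D (c + e) = c

/-- A CSS code on `n` qubits: two binary linear codes with `C_Z^⊥ ⊆ C_X`. -/
structure CSSCode (n : ℕ) where
  CX : Submodule (ZMod 2) (Bits n)
  CZ : Submodule (ZMod 2) (Bits n)
  dual_le : dualCode CZ ≤ CX

namespace CSSCode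

variable {n : ℕ} (Q : CSSCode n)

/-- The dimension of `C_X`. -/
def kx : ℕ := Module.finrank (ZMod 2) Q.CX

/-- The dimension of `C_Z`. -/
def kz : ℕ := Module.finrank (ZMod 2) Q.CZ

/-- The number `k = k_x + k_z - n` of logical qubits. -/
def k : ℕ := Q.kx + Q.kz - n

theorem k_add_le : Q.k + (n - Q.kx) ≤ n := by
  have hx : Q.kx ≤ n := by
    simpa [kx] using Submodule.finrank_le Q.CX
  have hz : Q.kz ≤ n := by
    simpa [kz] using Submodule.finrank_le Q.CZ
  unfold k
  omega

/-- The position of the `i`-th logical bit among the `n` unencoded bits. -/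
def logicalIdx (i : Fin Q.k) : Fin n :=
  ⟨i, by have := Q.k_add_le; omega⟩

/-- The position of the `j`-th syndrome bit among the `n` unencoded bits. -/
def syndromeIdx (j : Fin (n - Q.kx)) : Fin n :=
  ⟨Q.k + j, by have := Q.k_add_le; omega⟩

/-- The logical bits `y_{[1,k]}`. -/
def logicalPart (y : Bits n) : Bits Q.k := fun i => y (Q.logicalIdx i)

/-- The `X`-syndrome bits `y_{[k+1,k+(n-k_x)]}`. -/
def syndromePart (y : Bits n) : Bits (n - Q.kx) := fun j => y (Q.syndromeIdx j)

/-- `T` is an unencoding map of the `X`-part of the code: applied to the outcome `x` of measuring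
all qubits in the `X` basis, it yields first the outcomes of `k` independent logical operators
`X(z)`, with `z ∈ C_Z`, and next the outcomes of `n - k_x` stabilizer generators `X(h)`, with
`h ∈ C_X^⊥`. The operator `X(z)` has outcome `z · x`, so these `z` and `h` are rows of `T`. As `T`
is invertible, the rows `h` form a basis of `C_X^⊥`, and the rows `z` form a basis of `C_Z` modulo
`C_X^⊥`. The other rows are arbitrary. -/
def IsUnencoding (T : GL (Fin n) (ZMod 2)) : Prop :=
  (∀ i, T.val (Q.logicalIdx i) ∈ Q.CZ) ∧ ∀ j, T.val (Q.syndromeIdx j) ∈ dualCode Q.CX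

end CSSCode

/-! ### Qubits -/

/-- The `n`-fold tensor power of a single-qubit operator, in the computational basis. -/
def tensorPow (n : ℕ) (M : Matrix (ZMod 2) (ZMod 2) ℂ) : Matrix (Bits n) (Bits n) ℂ :=
  Matrix.of fun x y => ∏ i, M (x i) (y i)

/-- The Pauli matrix `Z`. -/
def pauliZ : Matrix (ZMod 2) (ZMod 2) ℂ :=
  Matrix.diagonal fun b => if b = 0 then 1 else -1

/-- The Hadamard matrix `H`. -/
def hadamard : Matrix (ZMod 2) (ZMod 2) ℂ :=
  Matrix.of fun a b => (if a = 1 ∧ b = 1 then -1 else 1) / (Real.sqrt 2 : ℂ)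

/-- The coherent error `U(θ) = (e^{iθZ})^{⊗n}`. -/
def coherentError (n : ℕ) (θ : ℝ) : Matrix (Bits n) (Bits n) ℂ :=
  tensorPow n (NormedSpace.exp ((Complex.I * θ) • pauliZ))

open Classical in
/-- The subspace state `|C⟩ = |C|^{-1/2} ∑_{x ∈ C} |x⟩`. -/
def subspaceState {n : ℕ} (C : Submodule (ZMod 2) (Bits n)) : Bits n → ℂ :=
  fun x => if x ∈ C then 1 / (Real.sqrt (Nat.card C) : ℂ) else 0

namespace CSSCode

variable {n : ℕ} (Q : CSSCode n)

/-- The encoded all-plus state of the CSS code, which is the subspace state of `C_Z`. -/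
def encodedPlus : Bits n → ℂ := subspaceState Q.CZ

/-- `p(x) = |⟨x| H^{⊗n} U(θ) |+̄⟩|²`, the probability of the outcome `x` when the corrupted code
state is measured in the `X` basis. -/
def outcomeProb (θ : ℝ) (x : Bits n) : ℝ :=
  ‖(tensorPow n hadamard *ᵥ (coherentError n θ *ᵥ Q.encodedPlus)) x‖ ^ 2

/-- The ideal output distribution `q(y) = p(T⁻¹ y)` of the unencoded string `y = T x`. -/
def idealDist (T : GL (Fin n) (ZMod 2)) (θ : ℝ) (y : Bits n) : ℝ :=
  Q.outcomeProb θ ((T⁻¹).val *ᵥ y)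

end CSSCode

/-! ### Probabilities -/

open Classical in
/-- The probability of the event `A` under the mass function `q`. -/
def prob {α : Type*} [Fintype α] (q : α → ℝ) (A : α → Prop) : ℝ :=
  ∑ y with A y, q y

/-- The conditional probability of `A` given `B` under the mass function `q`
(only meaningful if `B` has positive probability). -/
def condProb {α : Type*} [Fintype α] (q : α → ℝ) (A B : α → Prop) : ℝ :=
  prob q (fun y => A y ∧ B y) / prob q B

/-- A negligible function: it tends to zero faster than every inverse polynomial. -/
def Negligible (ν : ℕ → ℝ) : Prop :=
  Asymptotics.SuperpolynomialDecay Filter.atTop (fun t : ℕ => (t : ℝ)) ν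

namespace CSSCode

variable {n : ℕ} (Q : CSSCode n)

/-- Under the distribution `q` of unencoded strings, the syndrome `s` occurs, and conditioned on it
some logical string `l` has probability at least `1 - ε`. -/
def IsPeaked (q : Bits n → ℝ) (ε : ℝ) (s : Bits (n - Q.kx)) : Prop :=
  0 < prob q (fun y => Q.syndromePart y = s) ∧
    ∃ l : Bits Q.k,
      1 - ε ≤ condProb q (fun y => Q.logicalPart y = l) (fun y => Q.syndromePart y = s)

end CSSCode

end

/-!
The coherent error is a superposition `U(θ) = ∑_e a(e) Z^e` of Pauli errors with
`|a(e)| ≤ |sin θ|^|e|` (`coherentError_mulVec`, `norm_errorAmp_le`). In the `X` basis, the state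
`Z^e |+̄⟩` is a unit vector supported on the coset `e + C_Z^⊥`
(`CSSCode.sum_norm_sq_shiftedState`, `CSSCode.shiftedState_eq_zero`).

Call an error light if its weight is at most `t`, and heavy otherwise. As `|sin θ|` is a small
multiple of `t / n`, the coefficients of the heavy errors have total modulus at most
`ε = exp (-t / 2)` (`sum_norm_errorAmp_le`). This `ℓ¹` bound is what makes interference between the
heavy errors harmless: by the triangle inequality their superposition has norm at most `ε`.

Since `C_X` corrects `t` errors, distinct light errors lie in distinct cosets of `C_X`, that is,
have distinct syndromes, so the syndrome of an outcome reached by a light error determines its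
logical bits (`CSSCode.IsUnencoding.logicalPart_eq`). Decode each syndrome to these bits. An outcome
on which this decoder fails has its amplitude from heavy errors only, so the total failure
probability is at most `ε²` (`CSSCode.IsUnencoding.exists_decoder`). By Markov's inequality the
conditional failure probability exceeds `ε` only on syndromes of total probability at most `ε`
(`CSSCode.one_sub_le_prob_isPeaked`), and `ε` is negligible in `t`.
-/

open Finset

/-! ### Signs and characters -/

/-- The sign character `b ↦ (-1)^b` of the two-element field. -/
noncomputable def bitSign (b : ZMod 2) : ℂ := if b = 0 then 1 else -1

theorem bitSign_zero : bitSign 0 = 1 := by simp [bitSign]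

theorem bitSign_of_ne_zero {a : ZMod 2} (h : a ≠ 0) : bitSign a = -1 := by simp [bitSign, h]

theorem bitSign_add (a b : ZMod 2) : bitSign (a + b) = bitSign a * bitSign b := by
  have h2 : (1 + 1 : ZMod 2) = 0 := by decide
  have h01 : ∀ c : ZMod 2, c = 0 ∨ c = 1 := by decide
  rcases h01 a with rfl | rfl <;> rcases h01 b with rfl | rfl <;> simp [bitSign, h2]

theorem bitSign_sum {ι : Type*} (s : Finset ι) (f : ι → ZMod 2) :
    bitSign (∑ i ∈ s, f i) = ∏ i ∈ s, bitSign (f i) := by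
  induction s using Finset.cons_induction with
  | empty => simp [bitSign_zero]
  | cons a s ha ih => rw [sum_cons, prod_cons, bitSign_add, ih]

theorem bitSign_dotProduct {n : ℕ} (x y : Bits n) :
    bitSign (x ⬝ᵥ y) = ∏ i, bitSign (x i * y i) := bitSign_sum _ _

theorem norm_bitSign (b : ZMod 2) : ‖bitSign b‖ = 1 := by
  unfold bitSign; split_ifs <;> simp

theorem sum_zmod_two {M : Type*} [AddCommMonoid M] (f : ZMod 2 → M) :
    ∑ b, f b = f 0 + f 1 :=
  Fin.sum_univ_two f

/-- The sign character of `x` sums to zero over a code unless `x` lies in the dual code. -/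
theorem sum_bitSign_dotProduct_eq_zero {n : ℕ} (C : Submodule (ZMod 2) (Bits n)) [DecidablePred (· ∈ C)]
    (x : Bits n) (hx : x ∉ dualCode C) :
    ∑ w with w ∈ C, bitSign (x ⬝ᵥ w) = 0 := by
  obtain ⟨c, hc, hxc⟩ : ∃ c ∈ C, x ⬝ᵥ c ≠ 0 := by
    by_contra! h
    exact hx h
  -- Translation by `c` permutes the code and flips every sign.
  have h : ∑ w with w ∈ C, bitSign (x ⬝ᵥ w) = ∑ w with w ∈ C, bitSign (x ⬝ᵥ (w + c)) := by
    symm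
    refine sum_equiv (Equiv.addRight c) (fun w => ?_) (fun w _ => rfl)
    simp [C.add_mem_iff_left hc]
  simp only [dotProduct_add, bitSign_add, bitSign_of_ne_zero hxc, mul_neg, mul_one,
    sum_neg_distrib] at h
  linear_combination h / 2

/-! ### Tensor powers and their isometries -/

theorem conjTranspose_tensorPow_mul (n : ℕ) (M N : Matrix (ZMod 2) (ZMod 2) ℂ) :
    (tensorPow n M)ᴴ * tensorPow n N = tensorPow n (Mᴴ * N) := by
  ext x y
  simp only [tensorPow, Matrix.mul_apply, Matrix.conjTranspose_apply, Matrix.of_apply, star_prod,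
    ← prod_mul_distrib]
  rw [Finset.prod_univ_sum, Fintype.piFinset_univ]

theorem tensorPow_one (n : ℕ) : tensorPow n 1 = 1 := by
  ext x y
  simp only [tensorPow, Matrix.of_apply, Matrix.one_apply, funext_iff]
  rw [prod_ite_zero]
  simp

theorem hadamard_apply (a b : ZMod 2) : hadamard a b = bitSign (a * b) / (Real.sqrt 2 : ℂ) := by
  have h01 : ∀ c : ZMod 2, c = 0 ∨ c = 1 := by decide
  rcases h01 a with rfl | rfl <;> rcases h01 b with rfl | rfl <;> simp [bitSign, hadamard]

theorem conjTranspose_hadamard_mul : hadamardᴴ * hadamard = 1 := by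
  have h2 : (Real.sqrt 2 : ℂ) * Real.sqrt 2 = 2 := by
    rw [← Complex.ofReal_mul, Real.mul_self_sqrt (by norm_num)]; norm_num
  have h0 : (Real.sqrt 2 : ℂ) ≠ 0 := by
    intro h; rw [h] at h2; norm_num at h2
  have h01 : ∀ c : ZMod 2, c = 0 ∨ c = 1 := by decide
  ext a b
  rw [Matrix.mul_apply, sum_zmod_two]
  rcases h01 a with rfl | rfl <;> rcases h01 b with rfl | rfl <;>
    simp [hadamard] <;> field_simp <;> rw [sq, h2] <;> norm_num

theorem sum_norm_sq_mulVec {ι : Type*} [Fintype ι] [DecidableEq ι] {U : Matrix ι ι ℂ}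
    (hU : Uᴴ * U = 1) (v : ι → ℂ) : ∑ x, ‖(U *ᵥ v) x‖ ^ 2 = ∑ x, ‖v x‖ ^ 2 := by
  have key : ∀ u : ι → ℂ, ((∑ x, ‖u x‖ ^ 2 : ℝ) : ℂ) = star u ⬝ᵥ u := by
    intro u
    simp [dotProduct, Complex.conj_mul']
  apply Complex.ofReal_injective
  rw [key, key, Matrix.star_mulVec, ← Matrix.dotProduct_mulVec, Matrix.mulVec_mulVec, hU,
    Matrix.one_mulVec]

theorem sum_norm_sq_tensorPow_hadamard_mulVec {n : ℕ} (v : Bits n → ℂ) :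
    ∑ x, ‖(tensorPow n hadamard *ᵥ v) x‖ ^ 2 = ∑ x, ‖v x‖ ^ 2 :=
  sum_norm_sq_mulVec
    (by rw [conjTranspose_tensorPow_mul, conjTranspose_hadamard_mul, tensorPow_one]) v

theorem tensorPow_hadamard_apply {n : ℕ} (x w : Bits n) :
    tensorPow n hadamard x w = bitSign (x ⬝ᵥ w) / (Real.sqrt 2 : ℂ) ^ n := by
  simp [tensorPow, hadamard_apply, prod_div_distrib, bitSign_dotProduct]

/-! ### Pauli expansion of the coherent error -/

/-- The coefficient `(cos θ)^(n-|e|) (i sin θ)^|e|` of the Pauli error `Z^e` in the coherent error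
`U(θ)`. -/
noncomputable def errorAmp {n : ℕ} (θ : ℝ) (e : Bits n) : ℂ :=
  ∏ i, if e i = 0 then (Real.cos θ : ℂ) else Complex.I * (Real.sin θ : ℂ)

theorem coherentError_eq_diagonal (n : ℕ) (θ : ℝ) :
    coherentError n θ =
      Matrix.diagonal fun w => ∏ i, Complex.exp ((bitSign (w i) * θ) * Complex.I) := by
  have h : (Complex.I * (θ : ℂ)) • pauliZ =
      Matrix.diagonal fun b : ZMod 2 => (bitSign b * θ) * Complex.I := by
    rw [pauliZ, ← Matrix.diagonal_smul]
    congr 1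
    funext b
    simp only [Pi.smul_apply, smul_eq_mul, bitSign]
    ring
  ext x y
  rw [coherentError, h, Matrix.exp_diagonal]
  simp only [tensorPow, Matrix.of_apply, Matrix.diagonal_apply, funext_iff]
  rw [prod_ite_zero]
  simp [Pi.coe_exp, Complex.exp_eq_exp_ℂ]

theorem exp_bitSign_mul (θ : ℝ) (b : ZMod 2) :
    Complex.exp ((bitSign b * θ) * Complex.I) =
      Real.cos θ + bitSign b * (Complex.I * Real.sin θ) := by
  unfold bitSign
  split_ifs
  · rw [one_mul, Complex.exp_mul_I]; push_cast; ring
  · rw [Complex.exp_mul_I]; push_cast; simp; ring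

theorem coherentError_mulVec {n : ℕ} (θ : ℝ) (v : Bits n → ℂ) (w : Bits n) :
    (coherentError n θ *ᵥ v) w = ∑ e, errorAmp θ e * (bitSign (e ⬝ᵥ w) * v w) := by
  have h : ∀ i, Complex.exp ((bitSign (w i) * θ) * Complex.I) =
      ∑ b : ZMod 2, (if b = 0 then (Real.cos θ : ℂ) else Complex.I * (Real.sin θ : ℂ)) *
        bitSign (b * w i) := by
    intro i
    rw [sum_zmod_two, exp_bitSign_mul]
    simp [bitSign_zero]
    ring
  rw [coherentError_eq_diagonal, Matrix.mulVec_diagonal]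
  simp only [h]
  rw [Finset.prod_univ_sum, Fintype.piFinset_univ, sum_mul]
  refine sum_congr rfl fun e _ => ?_
  rw [prod_mul_distrib, bitSign_dotProduct, errorAmp, mul_assoc]

theorem sum_norm_sq_coherentError_mulVec {n : ℕ} (θ : ℝ) (v : Bits n → ℂ) :
    ∑ x, ‖(coherentError n θ *ᵥ v) x‖ ^ 2 = ∑ x, ‖v x‖ ^ 2 := by
  refine sum_congr rfl fun x _ => ?_
  have h : ∀ i, ‖Complex.exp ((bitSign (x i) * θ) * Complex.I)‖ = 1 := by
    intro i
    unfold bitSign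
    split_ifs
    · simp
    · simpa using Complex.norm_exp_ofReal_mul_I (-θ)
  rw [coherentError_eq_diagonal, Matrix.mulVec_diagonal, norm_mul, norm_prod]
  simp [h]

theorem norm_errorAmp_le {n : ℕ} (θ : ℝ) (e : Bits n) :
    ‖errorAmp θ e‖ ≤ |Real.sin θ| ^ hammingNorm e := by
  rw [errorAmp, norm_prod]
  calc ∏ i, ‖if e i = 0 then (Real.cos θ : ℂ) else Complex.I * (Real.sin θ : ℂ)‖
      ≤ ∏ i, (if e i ≠ 0 then |Real.sin θ| else 1) := by
        refine prod_le_prod (fun _ _ => norm_nonneg _) fun i _ => ?_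
        by_cases h : e i = 0
        · rw [if_pos h, if_neg (not_not.mpr h), Complex.norm_real]
          exact Real.abs_cos_le_one θ
        · rw [if_neg h, if_pos h, norm_mul, Complex.norm_I, one_mul, Complex.norm_real,
            Real.norm_eq_abs]
    _ = |Real.sin θ| ^ hammingNorm e := by
        rw [prod_ite, prod_const, prod_const_one, mul_one]
        rfl

theorem sum_pow_hammingNorm (n : ℕ) (r : ℝ) :
    ∑ e : Bits n, r ^ hammingNorm e = (1 + r) ^ n := by
  have h : ∀ e : Bits n, r ^ hammingNorm e = ∏ i, if e i ≠ 0 then r else 1 := by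
    intro e
    rw [prod_ite, prod_const, prod_const_one, mul_one]
    rfl
  simp only [h]
  rw [← Fintype.piFinset_univ, ← Finset.prod_univ_sum (fun _ => univ)
    (fun _ b => if b ≠ 0 then r else 1)]
  simp [sum_zmod_two]

/-- The Pauli coefficients of weight above `t` have small total modulus: the weight is controlled
by its exponential moment. -/
theorem sum_norm_errorAmp_le {n t : ℕ} {θ : ℝ}
    (hθ : |θ| ≤ Real.arcsin (((t : ℝ) / n) / (2 * Real.exp 1 * (4 * Real.exp 1 + 2)))) :
    ∑ e : Bits n with t < hammingNorm e, ‖errorAmp θ e‖ ≤ Real.exp (-1 / 2) ^ t := by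
  have he : 1 ≤ Real.exp 1 := by simp
  set K : ℝ := 2 * Real.exp 1 * (4 * Real.exp 1 + 2) with hK
  have hKpos : 0 < K := by positivity
  have hz : 0 ≤ ((t : ℝ) / n) / K := by positivity
  have hsin : |Real.sin θ| ≤ ((t : ℝ) / n) / K := by
    have h1 : |Real.sin θ| ≤ Real.sin |θ| := by
      have h0 : 0 ≤ Real.sin |θ| := Real.sin_nonneg_of_nonneg_of_le_pi (abs_nonneg θ)
        ((hθ.trans (Real.arcsin_le_pi_div_two _)).trans (by linarith [Real.pi_pos]))
      rcases abs_choice θ with h | h <;> rw [h] at h0 ⊢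
      · exact (abs_of_nonneg h0).le
      · rw [← abs_neg, ← Real.sin_neg, abs_of_nonneg h0]
    refine h1.trans ((Real.le_arcsin_iff_sin_le' ⟨?_, ?_⟩).mp hθ)
    · linarith [Real.pi_pos, abs_nonneg θ]
    · exact hθ.trans (Real.arcsin_le_pi_div_two _)
  set x := |Real.sin θ| with hx
  have hx0 : 0 ≤ x := abs_nonneg _
  have hnx : n * x ≤ t / K := by
    rcases Nat.eq_zero_or_pos n with rfl | hn
    -- For `n = 0` the quotient `t / n` is the junk value `0`, and the left side vanishes anyway.
    · simp only [Nat.cast_zero, zero_mul]; positivity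
    · have hn' : (0 : ℝ) < n := by exact_mod_cast hn
      calc n * x ≤ n * (((t : ℝ) / n) / K) := by gcongr
        _ = t / K := by field_simp
  have hexp : n * (Real.exp 1 * x) ≤ t / 2 := by
    calc n * (Real.exp 1 * x) = Real.exp 1 * (n * x) := by ring
      _ ≤ Real.exp 1 * (t / K) := by gcongr
      _ = t / (2 * (4 * Real.exp 1 + 2)) := by rw [hK]; field_simp
      _ ≤ t / 2 := by gcongr; linarith
  -- For `|e| > t` the factor `exp (|e| - t)` is at least one, and the sum with it factorizes.
  calc ∑ e : Bits n with t < hammingNorm e, ‖errorAmp θ e‖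
      ≤ ∑ e : Bits n with t < hammingNorm e,
          Real.exp (-t) * (Real.exp 1 * x) ^ hammingNorm e := by
        refine sum_le_sum fun e hew => ?_
        have hw : (t : ℝ) < hammingNorm e := by exact_mod_cast (mem_filter.mp hew).2
        have h1 : 1 ≤ Real.exp (-t) * Real.exp 1 ^ hammingNorm e := by
          rw [← Real.exp_nat_mul, ← Real.exp_add]
          exact Real.one_le_exp (by linarith)
        rw [mul_pow, ← mul_assoc]
        exact (norm_errorAmp_le θ e).trans (le_mul_of_one_le_left (by positivity) h1)
    _ ≤ ∑ e : Bits n, Real.exp (-t) * (Real.exp 1 * x) ^ hammingNorm e :=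
        sum_le_sum_of_subset_of_nonneg (filter_subset _ _) fun _ _ _ => by positivity
    _ = Real.exp (-t) * (1 + Real.exp 1 * x) ^ n := by rw [← mul_sum, sum_pow_hammingNorm]
    _ ≤ Real.exp (-t) * Real.exp (Real.exp 1 * x) ^ n := by
        gcongr
        linarith [Real.add_one_le_exp (Real.exp 1 * x)]
    _ ≤ Real.exp (-1 / 2) ^ t := by
        rw [← Real.exp_nat_mul, ← Real.exp_nat_mul, ← Real.exp_add]
        exact Real.exp_le_exp.mpr (by linarith)

/-! ### The measured state -/

theorem sum_norm_sq_subspaceState {n : ℕ} (C : Submodule (ZMod 2) (Bits n)) :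
    ∑ x, ‖subspaceState C x‖ ^ 2 = 1 := by
  classical
  have hpos : (0 : ℝ) < Nat.card C := by exact_mod_cast Nat.card_pos
  have h : ∀ x, ‖subspaceState C x‖ ^ 2 = if x ∈ C then 1 / (Nat.card C : ℝ) else 0 := by
    intro x
    unfold subspaceState
    split_ifs
    · rw [norm_div, norm_one, Complex.norm_real, Real.norm_eq_abs, div_pow, sq_abs, one_pow,
        Real.sq_sqrt hpos.le]
    · simp
  have hcard : (#{x | x ∈ C} : ℝ) = Nat.card C := by
    rw [Nat.card_eq_fintype_card, Fintype.card_subtype]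
  simp only [h]
  rw [← sum_filter, sum_const, nsmul_eq_mul, hcard]
  field_simp

namespace CSSCode

variable {n : ℕ} (Q : CSSCode n)

/-- The state `H^{⊗n} Z^e |+̄⟩`: the encoded all-plus state, hit by the Pauli error `Z^e` and
written in the `X` basis. -/
noncomputable def shiftedState (e : Bits n) : Bits n → ℂ :=
  tensorPow n hadamard *ᵥ fun w => bitSign (e ⬝ᵥ w) * Q.encodedPlus w

theorem sum_norm_sq_shiftedState (e : Bits n) : ∑ x, ‖Q.shiftedState e x‖ ^ 2 = 1 := by
  rw [shiftedState, sum_norm_sq_tensorPow_hadamard_mulVec]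
  simp [norm_bitSign, encodedPlus, sum_norm_sq_subspaceState]

/-- `H^{⊗n} Z^e |+̄⟩` is supported on the coset `e + C_Z^⊥`. -/
theorem shiftedState_eq_zero {e x : Bits n} (h : x + e ∉ dualCode Q.CZ) :
    Q.shiftedState e x = 0 := by
  classical
  have h0 := sum_bitSign_dotProduct_eq_zero Q.CZ (x + e) h
  rw [sum_filter] at h0
  calc Q.shiftedState e x
      = ∑ w, tensorPow n hadamard x w * (bitSign (e ⬝ᵥ w) * Q.encodedPlus w) := rfl
    _ = (1 / (Real.sqrt 2 : ℂ) ^ n * (1 / (Real.sqrt (Nat.card Q.CZ) : ℂ))) *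
          ∑ w, if w ∈ Q.CZ then bitSign ((x + e) ⬝ᵥ w) else 0 := by
        rw [mul_sum]
        refine sum_congr rfl fun w _ => ?_
        rw [tensorPow_hadamard_apply, encodedPlus, subspaceState, add_dotProduct, bitSign_add]
        split_ifs
        · ring
        · simp
    _ = 0 := by rw [h0, mul_zero]

theorem outcomeProb_eq (θ : ℝ) (x : Bits n) :
    Q.outcomeProb θ x = ‖∑ e, errorAmp θ e * Q.shiftedState e x‖ ^ 2 := by
  rw [outcomeProb]
  congr 2
  simp only [shiftedState, Matrix.mulVec, dotProduct]
  have h : ∀ w, (fun j => coherentError n θ w j) ⬝ᵥ Q.encodedPlus =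
      ∑ e, errorAmp θ e * (bitSign (e ⬝ᵥ w) * Q.encodedPlus w) :=
    fun w => coherentError_mulVec θ Q.encodedPlus w
  simp only [dotProduct] at h
  simp only [h, mul_sum]
  rw [sum_comm]
  refine sum_congr rfl fun e _ => sum_congr rfl fun w _ => ?_
  ring

theorem sum_outcomeProb (θ : ℝ) : ∑ x, Q.outcomeProb θ x = 1 := by
  simp only [outcomeProb]
  rw [sum_norm_sq_tensorPow_hadamard_mulVec, sum_norm_sq_coherentError_mulVec]
  exact sum_norm_sq_subspaceState Q.CZ

/-- By the triangle inequality, a superposition of shifted states has norm at most the total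
modulus of its coefficients. -/
theorem sum_norm_sq_superposition_le (S : Finset (Bits n)) (a : Bits n → ℂ) :
    ∑ x, ‖∑ e ∈ S, a e * Q.shiftedState e x‖ ^ 2 ≤ (∑ e ∈ S, ‖a e‖) ^ 2 := by
  let v : Bits n → EuclideanSpace ℂ (Bits n) := fun e => WithLp.toLp 2 (Q.shiftedState e)
  have hv : ∀ e, ‖v e‖ = 1 := by
    intro e
    rw [EuclideanSpace.norm_eq]
    simp [v, Q.sum_norm_sq_shiftedState e]
  have h : ∑ x, ‖∑ e ∈ S, a e * Q.shiftedState e x‖ ^ 2 = ‖∑ e ∈ S, a e • v e‖ ^ 2 := by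
    rw [EuclideanSpace.norm_sq_eq]
    simp [v]
  rw [h]
  gcongr
  refine (norm_sum_le _ _).trans_eq (sum_congr rfl fun e _ => ?_)
  rw [norm_smul, hv, mul_one]

/-! ### Decoding the syndrome -/

variable {Q} {T : GL (Fin n) (ZMod 2)}

theorem row_dotProduct_inv_mulVec (T : GL (Fin n) (ZMod 2)) (y : Bits n) (i : Fin n) :
    T.val i ⬝ᵥ ((T⁻¹).val *ᵥ y) = y i := by
  have h : T.val *ᵥ ((T⁻¹).val *ᵥ y) = y := by
    rw [Matrix.mulVec_mulVec, ← Units.val_mul, mul_inv_cancel, Units.val_one, Matrix.one_mulVec]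
  exact congrFun h i

/-- Outcomes with the same syndrome differ by a codeword of `C_X`. The code is contained in the
kernel of the syndrome map, and they have the same dimension because that map is onto. -/
theorem IsUnencoding.sub_mem (hT : Q.IsUnencoding T) {y y' : Bits n}
    (h : Q.syndromePart y = Q.syndromePart y') :
    (T⁻¹).val *ᵥ y - (T⁻¹).val *ᵥ y' ∈ Q.CX := by
  let S : Bits n →ₗ[ZMod 2] Bits (n - Q.kx) :=
    (LinearMap.funLeft (ZMod 2) (ZMod 2) Q.syndromeIdx).comp (Matrix.mulVecLin T.val)
  have hS : ∀ v j, S v j = T.val (Q.syndromeIdx j) ⬝ᵥ v := fun _ _ => rfl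
  have hinj : Function.Injective Q.syndromeIdx := by
    intro i j hij
    have := congrArg Fin.val hij
    simp only [syndromeIdx] at this
    exact Fin.ext (by omega)
  have hsurj : Function.Surjective S := by
    intro s
    obtain ⟨y, hy⟩ := LinearMap.funLeft_surjective_of_injective (ZMod 2) (ZMod 2) _ hinj s
    refine ⟨(T⁻¹).val *ᵥ y, ?_⟩
    funext j
    rw [hS, row_dotProduct_inv_mulVec, ← hy, LinearMap.funLeft_apply]
  have hle : Q.CX ≤ LinearMap.ker S := by
    intro c hc
    rw [LinearMap.mem_ker]
    funext j
    rw [hS]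
    exact hT.2 j c hc
  have hrank := S.finrank_range_add_finrank_ker
  have hkx : Q.kx ≤ n := by simpa [kx] using Submodule.finrank_le Q.CX
  rw [LinearMap.range_eq_top.mpr hsurj, finrank_top] at hrank
  simp only [Module.finrank_fin_fun] at hrank
  have hker : Q.CX = LinearMap.ker S :=
    Submodule.eq_of_le_of_finrank_eq hle (by change Q.kx = _; omega)
  rw [hker, LinearMap.mem_ker]
  funext j
  rw [hS, dotProduct_sub, row_dotProduct_inv_mulVec, row_dotProduct_inv_mulVec]
  exact sub_eq_zero.mpr (congrFun h j)

/-- The syndrome determines the logical bits, among the outcomes reached from the code by an error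
of weight at most `t`. -/
theorem IsUnencoding.logicalPart_eq (hT : Q.IsUnencoding T) {t : ℕ} (ht : CorrectsErrors Q.CX t)
    {y y' e e' : Bits n} (h : Q.syndromePart y = Q.syndromePart y')
    (he : hammingNorm e ≤ t) (he' : hammingNorm e' ≤ t)
    (hy : (T⁻¹).val *ᵥ y + e ∈ dualCode Q.CZ) (hy' : (T⁻¹).val *ᵥ y' + e' ∈ dualCode Q.CZ) :
    Q.logicalPart y = Q.logicalPart y' := by
  obtain ⟨D, hD⟩ := ht
  have hmem : e - e' ∈ Q.CX := by
    have h1 := Q.CX.sub_mem (Q.dual_le ((dualCode Q.CZ).sub_mem hy hy')) (hT.sub_mem h)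
    convert h1 using 1
    abel
  have h1 := hD 0 Q.CX.zero_mem e he
  have h2 := hD _ hmem e' he'
  rw [zero_add] at h1
  rw [sub_add_cancel, h1] at h2
  have hee : e = e' := sub_eq_zero.mp h2.symm
  subst hee
  have hd := (dualCode Q.CZ).sub_mem hy hy'
  rw [add_sub_add_right_eq_sub] at hd
  funext i
  have := hd _ (hT.1 i)
  rw [sub_dotProduct, dotProduct_comm, row_dotProduct_inv_mulVec, dotProduct_comm,
    row_dotProduct_inv_mulVec] at this
  exact sub_eq_zero.mp this

theorem idealDist_nonneg (T : GL (Fin n) (ZMod 2)) (θ : ℝ) (y : Bits n) :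
    0 ≤ Q.idealDist T θ y := sq_nonneg _

theorem sum_comp_inv_mulVec (T : GL (Fin n) (ZMod 2)) (f : Bits n → ℝ) :
    ∑ y, f ((T⁻¹).val *ᵥ y) = ∑ x, f x := by
  refine Function.Bijective.sum_comp (e := fun y : Bits n => (T⁻¹).val *ᵥ y) ?_ f
  refine Function.bijective_iff_has_inverse.mpr
    ⟨fun x => T.val *ᵥ x, fun y => funext (row_dotProduct_inv_mulVec T y), fun x => ?_⟩
  change (T⁻¹).val *ᵥ (T.val *ᵥ x) = x
  rw [Matrix.mulVec_mulVec, ← Units.val_mul, inv_mul_cancel, Units.val_one, Matrix.one_mulVec]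

theorem sum_idealDist (T : GL (Fin n) (ZMod 2)) (θ : ℝ) : ∑ y, Q.idealDist T θ y = 1 :=
  (sum_comp_inv_mulVec T _).trans (Q.sum_outcomeProb θ)

/-- Decoding the syndrome to the logical string of its unique light error fails with small
probability: where it fails, only the heavy errors contribute to the amplitude. -/
theorem IsUnencoding.exists_decoder (hT : Q.IsUnencoding T) {t : ℕ}
    (ht : CorrectsErrors Q.CX t) {θ : ℝ}
    (hθ : |θ| ≤ Real.arcsin (((t : ℝ) / n) / (2 * Real.exp 1 * (4 * Real.exp 1 + 2)))) :
    ∃ l : Bits (n - Q.kx) → Bits Q.k,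
      prob (Q.idealDist T θ) (fun y => Q.logicalPart y ≠ l (Q.syndromePart y)) ≤
        (Real.exp (-1 / 2) ^ t) ^ 2 := by
  classical
  let light : Bits n → Prop := fun y =>
    ∃ e, hammingNorm e ≤ t ∧ (T⁻¹).val *ᵥ y + e ∈ dualCode Q.CZ
  let l : Bits (n - Q.kx) → Bits Q.k := fun s =>
    if h : ∃ y, Q.syndromePart y = s ∧ light y then Q.logicalPart h.choose else 0
  have hl : ∀ y, light y → Q.logicalPart y = l (Q.syndromePart y) := by
    intro y hy
    have h : ∃ y', Q.syndromePart y' = Q.syndromePart y ∧ light y' := ⟨y, rfl, hy⟩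
    simp only [l, dif_pos h]
    obtain ⟨hs, e', he', hy'⟩ := h.choose_spec
    obtain ⟨e, he, hy⟩ := hy
    exact hT.logicalPart_eq ht hs.symm he he' hy hy'
  let heavy : Bits n → ℝ := fun x =>
    ‖∑ e with t < hammingNorm e, errorAmp θ e * Q.shiftedState e x‖ ^ 2
  refine ⟨l, ?_⟩
  calc prob (Q.idealDist T θ) (fun y => Q.logicalPart y ≠ l (Q.syndromePart y))
      = ∑ y with Q.logicalPart y ≠ l (Q.syndromePart y), Q.idealDist T θ y := by
        simp only [prob]
    _ ≤ ∑ y with Q.logicalPart y ≠ l (Q.syndromePart y), heavy ((T⁻¹).val *ᵥ y) := by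
        refine sum_le_sum fun y hy => le_of_eq ?_
        have hy : ¬ light y := fun h => (mem_filter.mp hy).2 (hl y h)
        rw [idealDist, outcomeProb_eq]
        simp only [heavy]
        congr 2
        symm
        refine sum_subset (filter_subset _ _) fun e _ he => ?_
        have he : hammingNorm e ≤ t := by simpa using he
        rw [Q.shiftedState_eq_zero fun h => hy ⟨e, he, h⟩, mul_zero]
    _ ≤ ∑ y, heavy ((T⁻¹).val *ᵥ y) :=
        sum_le_sum_of_subset_of_nonneg (filter_subset _ _) fun _ _ _ => sq_nonneg _
    _ = ∑ x, heavy x := sum_comp_inv_mulVec T heavy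
    _ ≤ (∑ e : Bits n with t < hammingNorm e, ‖errorAmp θ e‖) ^ 2 :=
        Q.sum_norm_sq_superposition_le _ _
    _ ≤ (Real.exp (-1 / 2) ^ t) ^ 2 := by
        gcongr
        exact sum_norm_errorAmp_le hθ

end CSSCode

/-! ### From the overall to the conditional error probability -/

theorem prob_nonneg {α : Type*} [Fintype α] {q : α → ℝ} (hq : ∀ y, 0 ≤ q y) (A : α → Prop) :
    0 ≤ prob q A :=
  sum_nonneg fun y _ => hq y

theorem prob_and_add_prob_and_not {α : Type*} [Fintype α] (q : α → ℝ) (A B : α → Prop) :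
    prob q (fun y => A y ∧ B y) + prob q (fun y => ¬ A y ∧ B y) = prob q B := by
  classical
  simp only [prob, sum_filter, ← sum_add_distrib]
  refine sum_congr rfl fun y _ => ?_
  by_cases hA : A y <;> by_cases hB : B y <;> simp [hA, hB]

theorem prob_add_prob_not {α : Type*} [Fintype α] (q : α → ℝ) (A : α → Prop) :
    prob q A + prob q (fun y => ¬ A y) = ∑ y, q y := by
  classical
  simp only [prob, sum_filter, ← sum_add_distrib]
  refine sum_congr rfl fun y _ => ?_
  by_cases hA : A y <;> simp [hA]

theorem prob_eq_sum_fiber {α σ : Type*} [Fintype α] [Fintype σ] (q : α → ℝ) (S : α → σ)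
    (A : α → Prop) : prob q A = ∑ s, prob q (fun y => A y ∧ S y = s) := by
  classical
  simp only [prob, sum_filter]
  rw [sum_comm]
  refine sum_congr rfl fun y _ => ?_
  by_cases hA : A y <;> simp [hA]

/-- Markov's inequality for the conditional error probability: if `A` fails with probability at
most `ε²`, then every set of values of `S` on which `A` fails with conditional probability at least
`ε` has probability at most `ε`. -/
theorem prob_le_of_mul_le {α σ : Type*} [Fintype α] [Fintype σ] {q : α → ℝ} (hq : ∀ y, 0 ≤ q y)
    (S : α → σ) (F : α → Prop) (U : σ → Prop) {ε : ℝ} (hε : 0 < ε) (hF : prob q F ≤ ε ^ 2)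
    (hU : ∀ s, U s → ε * prob q (fun y => S y = s) ≤ prob q (fun y => F y ∧ S y = s)) :
    prob q (fun y => U (S y)) ≤ ε := by
  have h : ε * prob q (fun y => U (S y)) ≤ prob q F := by
    rw [prob_eq_sum_fiber q S F, prob_eq_sum_fiber q S (fun y => U (S y)), mul_sum]
    refine sum_le_sum fun s _ => ?_
    by_cases hs : U s
    · have hiff : (fun y => U (S y) ∧ S y = s) = fun y => S y = s := by
        funext y
        simp only [eq_iff_iff, and_iff_right_iff_imp]
        rintro rfl
        exact hs
      rw [hiff]
      exact hU s hs
    · have hiff : (fun y => U (S y) ∧ S y = s) = fun _ => False := by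
        funext y
        simp only [eq_iff_iff, iff_false, not_and]
        rintro h rfl
        exact hs h
      rw [hiff]
      simpa [prob] using prob_nonneg hq (fun y => F y ∧ S y = s)
  exact le_of_mul_le_mul_left ((h.trans hF).trans_eq (sq ε)) hε

theorem CSSCode.one_sub_le_prob_isPeaked {n : ℕ} (Q : CSSCode n) {q : Bits n → ℝ}
    (hq : ∀ y, 0 ≤ q y) (hq1 : ∑ y, q y = 1) (l : Bits (n - Q.kx) → Bits Q.k) {ε : ℝ} (hε : 0 < ε)
    (h : prob q (fun y => Q.logicalPart y ≠ l (Q.syndromePart y)) ≤ ε ^ 2) :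
    1 - ε ≤ prob q (fun y => Q.IsPeaked q ε (Q.syndromePart y)) := by
  have hadd := prob_add_prob_not q (fun y => Q.IsPeaked q ε (Q.syndromePart y))
  suffices hU : prob q (fun y => ¬ Q.IsPeaked q ε (Q.syndromePart y)) ≤ ε by linarith
  refine prob_le_of_mul_le hq Q.syndromePart _ (fun s => ¬ Q.IsPeaked q ε s) hε h fun s hs => ?_
  have hfail : (fun y => Q.logicalPart y ≠ l (Q.syndromePart y) ∧ Q.syndromePart y = s) =
      fun y => ¬ Q.logicalPart y = l s ∧ Q.syndromePart y = s := by
    funext y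
    simp only [eq_iff_iff, ne_eq, and_congr_left_iff]
    rintro rfl
    rfl
  rw [hfail]
  -- Syndromes of probability zero are not peaked by definition, and satisfy the bound trivially.
  rcases (prob_nonneg hq fun y => Q.syndromePart y = s).eq_or_lt with h0 | hpos
  · rw [← h0, mul_zero]
    exact prob_nonneg hq _
  · have hlt : condProb q (fun y => Q.logicalPart y = l s) (fun y => Q.syndromePart y = s) <
        1 - ε := by
      by_contra! hge
      exact hs ⟨hpos, l s, hge⟩
    rw [condProb, div_lt_iff₀ hpos] at hlt
    have := prob_and_add_prob_and_not q (fun y => Q.logicalPart y = l s)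
      (fun y => Q.syndromePart y = s)
    linarith

theorem negligible_pow {r : ℝ} (h0 : 0 ≤ r) (h1 : r < 1) : Negligible fun t => r ^ t :=
  fun k => tendsto_pow_const_mul_const_pow_of_lt_one k h0 h1

theorem theorem2 :
    ∃ ν : ℕ → ℝ, Negligible ν ∧
      ∀ (n t : ℕ) (Q : CSSCode n) (T : GL (Fin n) (ZMod 2)) (θ : ℝ),
        Q.IsUnencoding T →
        CorrectsErrors Q.CX t →
        |θ| ≤ Real.arcsin (((t : ℝ) / n) / (2 * Real.exp 1 * (4 * Real.exp 1 + 2))) →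
        1 - ν t ≤
          prob (Q.idealDist T θ) (fun y => Q.IsPeaked (Q.idealDist T θ) (ν t) (Q.syndromePart y)) := by
  refine ⟨fun t => Real.exp (-1 / 2) ^ t,
    negligible_pow (Real.exp_pos _).le (Real.exp_lt_one_iff.mpr (by norm_num)), ?_⟩
  intro n t Q T θ hT ht hθ
  obtain ⟨l, hl⟩ := hT.exists_decoder ht hθ
  exact Q.one_sub_le_prob_isPeaked (CSSCode.idealDist_nonneg T θ) (CSSCode.sum_idealDist T θ) l
    (by positivity) hl
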